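/- Let $\mathcal L$ be a finite relational language and let $K$ be a Fraïssé class of finite $\mathcal L$-structures, containing a nonempty structure, with the strong amalgamation property (SAP): for all $A,B,C\in K$ and embeddings $e:A\to B$, $f:A\to C$ there are $D\in K$ and embeddings $g:B\to D$, $h:C\to D$ with $ge=hf$ and $\operatorname{im}(g)\cap\operatorname{im}(h)=\operatorname{im}(ge)$. Let $T$ be the complete theory of the Fraïssé limit of $K$. Let $\mathcal L_{pfc}$ be the two-sorted language with sorts $O$ and $P$ which has, for each $n$-ary relation symbol $R$ of $\mathcal L$, a relation symbol $R_x(y_1,\dots,y_n)$ with $x$ of sort $P$ and $y_1,\dots,y_n$ of sort $O$. For an $\mathcal L_{pfc}$-structure $(A,B)$ (with $A$ the sort $O$ and $B$ the sort $P$) and $b\in B$, let $A_b$ be the $\mathcal L$-structure with domain $A$ in which each $R$ is interpreted as $R_b$. Let $K_{pfc}$ be the class of finite $\mathcal L_{pfc}$-structures $(A,B)$ such that for every $b\in B$ the structure $A_b$ is isomorphic to a member of $K$. Let $T_{pfc}$ be the complete theory of the Fraïssé limit of $K_{pfc}$, i.e. of the countable ultrahomogeneous $\mathcal L_{pfc}$-structure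 with age $K_{pfc}$ (which exists and is unique up to isomorphism). A theory is called geometric if it eliminates the quantifier $\exists^\infty$ (for every formula $\varphi(x,\bar y)$ with $x$ a single variable there is a formula $\psi(\bar y)$ such that in every model, $\psi(\bar b)$ holds if and only if $\varphi(x,\bar b)$ has infinitely many solutions) and the model-theoretic algebraic closure $\operatorname{acl}$ satisfies the exchange property in all of its models. If $T$ is geometric and $\operatorname{acl}(A)=A$ for every subset $A$ of every model of $T$, then $T_{pfc}$ is geometric and $\operatorname{acl}(A)=A$ for every subset $A$ of every model of $T_{pfc}$. -/

import Mathlib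

open FirstOrder FirstOrder.Language CategoryTheory

universe u v w w'

/-- The strong amalgamation property (SAP) of a class of structures. -/
def StrongAmalgamation {L : FirstOrder.Language.{u, v}} (K : Set (Bundled.{w} L.Structure)) : Prop :=
  ∀ A B C : Bundled.{w} L.Structure, A ∈ K → B ∈ K → C ∈ K →
    ∀ (e : A ↪[L] B) (f : A ↪[L] C),
      ∃ D : Bundled.{w} L.Structure, D ∈ K ∧ ∃ (g : B ↪[L] D) (h : C ↪[L] D),
        g.comp e = h.comp f ∧
          Set.range g ∩ Set.range h = Set.range (g.comp e)

/-- The model-theoretic algebraic closure of a set `A` in an `L`-structure `M`: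
the union of all finite subsets of `M` that are definable with parameters from `A`. -/
def acl (L : FirstOrder.Language.{u, v}) {M : Type w} [L.Structure M] (A : Set M) : Set M :=
  {a | ∃ s : Set M, A.Definable₁ L s ∧ s.Finite ∧ a ∈ s}

/-- `T` eliminates the quantifier "there exist infinitely many": for every formula `φ(x, y)`,
with `x` a single variable and `y` a tuple, there is a formula `ψ(y)` such that in all models of
`T`, `ψ(b)` holds if and only if `φ(x, b)` has infinitely many solutions. -/
def EliminatesExistsInfinity {L : FirstOrder.Language.{u, v}} (T : L.Theory) : Prop :=
  ∀ (n : ℕ) (φ : L.Formula (Fin (n + 1))), ∃ ψ : L.Formula (Fin n),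
    ∀ (M : Theory.ModelType.{u, v, w} T) (b : Fin n → M),
      ψ.Realize b ↔ {a : M | φ.Realize (Fin.cons a b : Fin (n + 1) → M)}.Infinite

/-- Algebraic closure satisfies the exchange property in all models of `T`. -/
def AclExchange {L : FirstOrder.Language.{u, v}} (T : L.Theory) : Prop :=
  ∀ (M : Theory.ModelType.{u, v, w} T) (A : Set M) (a b : M),
    a ∈ acl L (A ∪ {b}) → a ∉ acl L A → b ∈ acl L (A ∪ {a})

/-- Geometric theories. The models range over the universe `w`. -/
structure IsGeometric {L : FirstOrder.Language.{u, v}} (T : L.Theory) : Prop where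
  eliminatesExistsInfinity : EliminatesExistsInfinity.{u, v, w} T
  aclExchange : AclExchange.{u, v, w} T

/-- The condition `acl(A) = A` for every subset `A` of every model of `T`. -/
def HasTrivialAcl {L : FirstOrder.Language.{u, v}} (T : L.Theory) : Prop :=
  ∀ (M : Theory.ModelType.{u, v, w} T) (A : Set M), acl L A = A

/-- The relation symbols of the language `L_pfc`. The two sorts `O` and `P` are given by unary
predicates; every `n`-ary relation symbol `R` of `L` yields an `(n + 1)`-ary symbol `R_x(y)`,
whose first argument `x` is of sort `P` and whose other arguments `y` are of sort `O`. -/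
inductive PfcRelations (L : FirstOrder.Language.{u, v}) : ℕ → Type v
  | sortO : PfcRelations L 1
  | sortP : PfcRelations L 1
  | rel {n : ℕ} (R : L.Relations n) : PfcRelations L (n + 1)

/-- The two-sorted language `L_pfc`. -/
def pfcLanguage (L : FirstOrder.Language.{u, v}) : FirstOrder.Language.{0, v} :=
  ⟨fun _ => Empty, PfcRelations L⟩

instance pfcLanguage.instIsRelational (L : FirstOrder.Language.{u, v}) : (pfcLanguage L).IsRelational :=
  fun _ => inferInstanceAs (IsEmpty Empty)

/-- A two-sorted `L_pfc`-structure `(A, B)`, with `A` the sort `O` and `B` the sort `P`, is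
the same thing as a family `S` of `L`-structures on `A` indexed by `B`, where `S b` is the
`L`-structure `A_b` associated to `b`. Its universe is the disjoint union of the two sorts. -/
@[reducible] def pfcStructure {L : FirstOrder.Language.{u, v}} {A B : Type w} (S : B → L.Structure A) :
    (pfcLanguage L).Structure (A ⊕ B) where
  funMap := fun f _ => f.elim
  RelMap := fun {n} (r : PfcRelations L n) =>
    match n, r with
    | _, .sortO => fun x => ∃ a : A, x 0 = Sum.inl a
    | _, .sortP => fun x => ∃ b : B, x 0 = Sum.inr b
    | _, .rel (n := k) R => fun x => ∃ (b : B) (a : Fin k → A),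
        x = Fin.cons (Sum.inr b) (fun i => Sum.inl (a i)) ∧ (S b).RelMap R a

/-- The class `K_pfc` of (structures isomorphic to) finite two-sorted `L_pfc`-structures
`(A, B)` such that for every `b` in `B`, `A_b` is isomorphic to some member of `K`. -/
def pfcClass {L : FirstOrder.Language.{u, v}} (K : Set (Bundled.{w} L.Structure)) :
    Set (Bundled.{w} (pfcLanguage L).Structure) :=
  {M | ∃ (A B : Type w) (S : B → L.Structure A), Finite A ∧ Finite B ∧
    (∀ b : B, ∃ D ∈ K, Nonempty (@FirstOrder.Language.Equiv L A D (S b) D.str)) ∧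
    Nonempty (@FirstOrder.Language.Equiv (pfcLanguage L) M (A ⊕ B) M.str (pfcStructure S))}

/-! Strong amalgamation passes from `K` to `pfcClass K`, and a Fraïssé limit of a class with strong
amalgamation always has a geometric theory with trivial algebraic closure.

For the transfer (`pfcClass_strongAmalgamation`), both sorts are amalgamated as pushouts of sets.
Each point `b` of the new sort P needs a member of `K` on the new sort O. If `b` comes from both
sides, the two given structures are amalgamated strongly. If it comes from one side only, its
structure is restricted to the common part and extended to the other side's sort O
(`exists_extension_to_finite`, which needs the limit of `K` to be infinite). Strong amalgamation
then applies.

For the second point, strong amalgamation and ultrahomogeneity move any point outside a finite set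
`s` off any finite set by an automorphism fixing `s` (`exists_automorphism_notMem`). So in the limit
a solution outside the parameters forces solutions outside every finite tuple. This is a scheme of
sentences, so it holds in all models of the theory. Hence `acl A = A`, exchange is immediate, and
"infinitely many solutions" means "a solution outside the parameters".

Existence of the limit for `pfcClass K` is a generic construction: an ideal of finite structures
meeting countably many cofinal sets (`exists_isFraisseLimit`). -/

/-! ### Induced structures in relational languages -/

section Comap

variable {L : FirstOrder.Language.{u, v}} [L.IsRelational]

/-- The structure induced on `A` by a map into a structure, in a relational language. -/
@[reducible] def comapStructure {A : Type*} {B : Type*} (f : A → B) (S : L.Structure B) :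
    L.Structure A where
  funMap := fun F _ => isEmptyElim F
  RelMap := fun R x => S.RelMap R (f ∘ x)

theorem relationalStructure_ext {A : Type*} {S T : L.Structure A}
    (h : ∀ (n : ℕ) (R : L.Relations n) (x : Fin n → A), S.RelMap R x ↔ T.RelMap R x) : S = T := by
  apply Structure.ext
  · funext n F
    exact isEmptyElim F
  · funext n R x
    exact propext (h n R x)

theorem comapStructure_comp {A B C : Type*} (f : A → B) (g : B → C) (S : L.Structure C) :
    comapStructure f (comapStructure g S) = comapStructure (g ∘ f) S :=
  rfl

theorem comapStructure_id {A : Type*} (S : L.Structure A) : comapStructure id S = S :=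
  relationalStructure_ext fun _ _ _ => Iff.rfl

theorem comapStructure_trans {A B C : Type*} {f : A → B} {g : B → C} {S : L.Structure A}
    {T : L.Structure B} {U : L.Structure C} (h : comapStructure f T = S)
    (h' : comapStructure g U = T) : comapStructure (g ∘ f) U = S := by
  subst h'
  exact h

theorem comapStructure_embedding {A B : Type*} {S : L.Structure A} {T : L.Structure B}
    (e : A ↪[L] B) : comapStructure e T = S :=
  relationalStructure_ext fun _ R x => e.map_rel R x

/-- An injective map along which a structure is induced is an embedding. -/
def embeddingOfComap {A B : Type*} {S : L.Structure A} {T : L.Structure B} (f : A → B)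
    (hf : Function.Injective f) (h : comapStructure f T = S) : A ↪[L] B where
  toFun := f
  inj' := hf
  map_fun' := fun F _ => isEmptyElim F
  map_rel' := fun R x => by subst h; exact Iff.rfl

theorem comapStructure_equiv {A B : Type*} {S : L.Structure A} {T : L.Structure B}
    (e : A ≃[L] B) : comapStructure e T = S :=
  relationalStructure_ext fun _ R x => e.map_rel R x

/-- A bijection along which a structure is induced is an isomorphism. -/
def equivOfComap {A B : Type*} {S : L.Structure A} {T : L.Structure B} (f : A ≃ B)
    (h : comapStructure f T = S) : A ≃[L] B where
  toEquiv := f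
  map_fun' := fun F _ => isEmptyElim F
  map_rel' := fun R x => by subst h; exact Iff.rfl

theorem finite_of_mem {K : Set (Bundled.{w} L.Structure)} (hK : IsFraisse K) {A : Type w}
    {S : L.Structure A} (hS : Bundled.mk A S ∈ K) : Finite A :=
  Structure.FG.finite (hK.FG _ hS)

theorem mem_of_comapStructure {K : Set (Bundled.{w} L.Structure)} (hK : IsFraisse K)
    {A B : Type w} [Finite A] {S : L.Structure A} {T : L.Structure B} (hT : Bundled.mk B T ∈ K)
    {f : A → B} (hf : Function.Injective f) (h : comapStructure f T = S) :
    Bundled.mk A S ∈ K :=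
  hK.hereditary _ hT ⟨Structure.fg_iff_finite.2 ‹_›, ⟨embeddingOfComap f hf h⟩⟩

theorem finite_relationalStructure [Finite (Σ n, L.Relations n)] (A : Type*) [Finite A] :
    Finite (L.Structure A) := by
  refine Finite.of_injective
    (fun S : L.Structure A => fun (R : Σ n, L.Relations n) (x : Fin R.1 → A) => S.RelMap R.2 x) ?_
  intro S T h
  refine relationalStructure_ext fun n R x => ?_
  exact iff_of_eq (congrFun (congrFun h ⟨n, R⟩) x)

end Comap

/-! ### Automorphisms of limits under strong amalgamation -/

section StrongAmalgamation

variable {L : FirstOrder.Language.{u, v}} [L.IsRelational] {K : Set (Bundled.{w} L.Structure)}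
  {M : Type w} [L.Structure M] [Countable M]

/-- In a Fraïssé limit of a class with strong amalgamation, an element outside a finite set `s` can
be moved out of any given finite set by an automorphism fixing `s` pointwise. -/
theorem exists_automorphism_notMem (hM : IsFraisseLimit K M) (hSAP : StrongAmalgamation K)
    {s F : Set M} (hs : s.Finite) (hF : F.Finite) {a : M} (ha : a ∉ s) :
    ∃ σ : M ≃[L] M, (∀ x ∈ s, σ x = x) ∧ σ a ∉ F := by
  let cl : Set M → L.Substructure M := fun t => Substructure.closure L t
  have mem_cl : ∀ (t : Set M) (x : M), x ∈ cl t ↔ x ∈ t := fun t x =>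
    Substructure.mem_closure_iff_of_isRelational L t x
  have hage : ∀ t : Set M, t.Finite → (Bundled.mk (cl t) inferInstance : Bundled L.Structure) ∈ K :=
    fun t ht => hM.age ▸ age.fg_substructure (Substructure.fg_closure ht)
  have hE : cl s ≤ cl (s ∪ F) := Substructure.closure_mono Set.subset_union_left
  have hC : cl s ≤ cl (s ∪ {a}) := Substructure.closure_mono Set.subset_union_left
  have hCfin : (s ∪ {a}).Finite := hs.union (Set.finite_singleton a)
  obtain ⟨D, hD, g, h, hgh, hrange⟩ := hSAP _ _ _ (hage s hs) (hage _ (hs.union hF))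
    (hage _ hCfin) (Substructure.inclusion hE) (Substructure.inclusion hC)
  have hDM : Nonempty (D ↪[L] M) := by
    rw [← hM.age] at hD
    exact hD.2
  -- The amalgam is placed in `M` so that `s ∪ F` stays where it is; `σ` then moves `s ∪ {a}` to its
  -- copy in the amalgam.
  obtain ⟨j, hj⟩ := hM.ultrahomogeneous.extend_embedding
    ((Substructure.fg_iff_structure_fg _).1 (Substructure.fg_closure (hs.union hF)))
    (Substructure.subtype (cl (s ∪ F))) g
  obtain ⟨σ, hσ⟩ := hM.ultrahomogeneous (cl (s ∪ {a})) (Substructure.fg_closure hCfin) (j.comp h)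
  have hjg : ∀ x : cl (s ∪ F), j (g x) = x := fun x => (DFunLike.congr_fun hj x).symm
  have hσh : ∀ x : cl (s ∪ {a}), σ x = j (h x) := fun x => (DFunLike.congr_fun hσ x).symm
  have hgh' : ∀ x : cl s, g (Substructure.inclusion hE x) = h (Substructure.inclusion hC x) :=
    fun x => DFunLike.congr_fun hgh x
  refine ⟨σ, fun x hx => ?_, fun hmem => ?_⟩
  · have hx' : x ∈ cl s := (mem_cl _ _).2 hx
    have := hσh (Substructure.inclusion hC ⟨x, hx'⟩)
    rw [← hgh', hjg] at this
    exact this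
  · have haC : a ∈ cl (s ∪ {a}) := (mem_cl _ _).2 (Or.inr rfl)
    have hmemE : σ a ∈ cl (s ∪ F) := (mem_cl _ _).2 (Or.inr hmem)
    -- If `σ a` were in `F`, then `h a` would lie in both images, hence come from `s`.
    have h1 : h ⟨a, haC⟩ = g ⟨σ a, hmemE⟩ := by
      apply j.injective
      rw [hjg, ← hσh]
    have h2 : h ⟨a, haC⟩ ∈ Set.range g ∩ Set.range h := ⟨⟨_, h1.symm⟩, ⟨_, rfl⟩⟩
    rw [hrange] at h2
    obtain ⟨x, hx⟩ := h2
    have h3 : h (Substructure.inclusion hC x) = h ⟨a, haC⟩ := (hgh' x).symm.trans hx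
    have h4 : (x : M) = a := congrArg Subtype.val (h.injective h3)
    exact ha (h4 ▸ (mem_cl _ _).1 x.2)

/-- If `M` were finite, taking `s = ∅` and `F = M` would move a point out of `M`. -/
theorem infinite_of_strongAmalgamation [Nonempty M] (hM : IsFraisseLimit K M)
    (hSAP : StrongAmalgamation K) : Infinite M := by
  obtain ⟨a⟩ := ‹Nonempty M›
  by_contra hfin
  rw [not_infinite_iff_finite] at hfin
  obtain ⟨σ, -, hσ⟩ := exists_automorphism_notMem hM hSAP Set.finite_empty
    (Set.toFinite (Set.univ : Set M)) (Set.notMem_empty a)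
  exact hσ (Set.mem_univ _)

end StrongAmalgamation

/-! ### First-order expression of avoiding finite tuples -/

section ExistsNotMem

variable {L : FirstOrder.Language.{u, v}}

/-- The formula expressing that some `x` different from all the variables `y (f j)` satisfies
`φ(y, x)`. -/
noncomputable def existsNotMem {ι κ β : Type*} [Finite κ] (g : ι → β) (f : κ → β)
    (φ : L.Formula (ι ⊕ Fin 1)) : L.Formula β :=
  Formula.iExs (Fin 1) (φ.relabel (Sum.map g id) ⊓
    BoundedFormula.iInf fun j : κ =>
      (Term.equal (Term.var (Sum.inr 0)) (Term.var (Sum.inl (f j))) : L.Formula (β ⊕ Fin 1)).not)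

theorem realize_existsNotMem {ι κ β : Type*} [Finite κ] (g : ι → β) (f : κ → β)
    (φ : L.Formula (ι ⊕ Fin 1)) {M : Type*} [L.Structure M] (v : β → M) :
    (existsNotMem g f φ).Realize v ↔
      ∃ a : M, φ.Realize (Sum.elim (v ∘ g) fun _ => a) ∧ ∀ j, a ≠ v (f j) := by
  have key : ∀ x : Fin 1 → M, Sum.elim v x ∘ Sum.map g id = Sum.elim (v ∘ g) fun _ => x 0 := by
    intro x
    funext i
    rcases i with i | i
    · rfl
    · simp [Subsingleton.elim i 0]
  rw [existsNotMem, Formula.realize_iExs]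
  constructor
  · rintro ⟨x, hx⟩
    rw [Formula.Realize, BoundedFormula.realize_inf, BoundedFormula.realize_iInf] at hx
    refine ⟨x 0, ?_, fun j => ?_⟩
    · rw [← key, ← Formula.realize_relabel]
      exact hx.1
    · have := hx.2 j
      rw [← Formula.Realize, Formula.realize_not, Formula.realize_equal] at this
      exact this
  · rintro ⟨a, ha, hne⟩
    refine ⟨fun _ => a, ?_⟩
    rw [Formula.Realize, BoundedFormula.realize_inf, BoundedFormula.realize_iInf]
    refine ⟨?_, fun j => ?_⟩
    · rw [← Formula.Realize, Formula.realize_relabel, key]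
      exact ha
    · rw [← Formula.Realize, Formula.realize_not, Formula.realize_equal]
      exact hne j

/-- The sentence expressing that if `φ(y, x)` has a solution `x` outside the tuple `y`, then it has
a solution outside any given tuple of length `k`. -/
noncomputable def avoidanceSentence {n : ℕ} (k : ℕ) (φ : L.Formula (Fin n ⊕ Fin 1)) : L.Sentence :=
  Formula.iAlls (Fin n ⊕ Fin k) (((existsNotMem Sum.inl Sum.inl φ).imp
    (existsNotMem Sum.inl Sum.inr φ)).relabel (Sum.inr (α := Empty)))

theorem realize_avoidanceSentence {n : ℕ} (k : ℕ) (φ : L.Formula (Fin n ⊕ Fin 1))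
    (X : Type*) [L.Structure X] : X ⊨ avoidanceSentence k φ ↔
      ∀ (b : Fin n → X) (c : Fin k → X),
        (∃ a : X, φ.Realize (Sum.elim b fun _ => a) ∧ ∀ i, a ≠ b i) →
          ∃ a : X, φ.Realize (Sum.elim b fun _ => a) ∧ ∀ j, a ≠ c j := by
  rw [Sentence.Realize, avoidanceSentence, Formula.realize_iAlls]
  constructor
  · intro h b c
    have := h (Sum.elim b c)
    rw [Formula.realize_relabel, Formula.realize_imp, realize_existsNotMem,
      realize_existsNotMem] at this
    exact this
  · intro h x
    rw [Formula.realize_relabel, Formula.realize_imp, realize_existsNotMem, realize_existsNotMem]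
    exact h (x ∘ Sum.inl) (x ∘ Sum.inr)

end ExistsNotMem

/-! ### Trivial algebraic closure and elimination of ∃^∞ -/

section TrivialAcl

variable {L : FirstOrder.Language.{u, v}} [L.IsRelational] {K : Set (Bundled.{w} L.Structure)}
  {M : Type w} [L.Structure M] [Countable M]

/-- In a Fraïssé limit of a class with strong amalgamation, a formula with a solution outside its
parameters has solutions outside any given finite tuple. -/
theorem models_avoidanceSentence (hM : IsFraisseLimit K M) (hSAP : StrongAmalgamation K) {n : ℕ}
    (k : ℕ) (φ : L.Formula (Fin n ⊕ Fin 1)) : M ⊨ avoidanceSentence k φ := by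
  rw [realize_avoidanceSentence]
  rintro b c ⟨a, ha, hab⟩
  obtain ⟨σ, hσ, hσa⟩ := exists_automorphism_notMem hM hSAP (Set.finite_range b)
    (Set.finite_range c) (a := a) (by rintro ⟨i, hi⟩; exact hab i hi.symm)
  refine ⟨σ a, ?_, fun j hj => hσa ⟨j, hj.symm⟩⟩
  have h1 := (StrongHomClass.realize_formula σ φ).2 ha
  have h2 : (σ ∘ Sum.elim b fun _ : Fin 1 => a) = Sum.elim b fun _ => σ a := by
    funext i
    rcases i with i | i
    · exact hσ _ ⟨i, rfl⟩
    · rfl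
  rwa [h2] at h1

/-- The automorphism argument is available only in `M`, but its first-order consequence transfers to
`N`: if the solutions formed a finite tuple `c`, the avoidance sentence of that length would give
one outside `c`. -/
theorem infinite_of_models_completeTheory (hM : IsFraisseLimit K M) (hSAP : StrongAmalgamation K)
    (N : Theory.ModelType.{u, v, w'} (L.completeTheory M)) {n : ℕ}
    (φ : L.Formula (Fin n ⊕ Fin 1)) (b : Fin n → N) {a : N}
    (ha : φ.Realize (Sum.elim b fun _ => a)) (hab : ∀ i, a ≠ b i) :
    {x : N | φ.Realize (Sum.elim b fun _ => x)}.Infinite := by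
  intro hfin
  obtain ⟨k, c, hc⟩ := hfin.fin_param
  have hN : N ⊨ avoidanceSentence k φ :=
    (L.completeTheory M).realize_sentence_of_mem (models_avoidanceSentence hM hSAP k φ)
  obtain ⟨a', ha', hne⟩ := (realize_avoidanceSentence k φ N).1 hN b c ⟨a, ha, hab⟩
  have : a' ∈ Set.range c := by
    rw [hc.2]
    exact ha'
  obtain ⟨j, hj⟩ := this
  exact hne j hj.symm

/-- The theory of a Fraïssé limit of a class with strong amalgamation has trivial algebraic
closure. -/
theorem hasTrivialAcl_of_strongAmalgamation (hM : IsFraisseLimit K M)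
    (hSAP : StrongAmalgamation K) : HasTrivialAcl.{u, v, w'} (L.completeTheory M) := by
  intro N A
  apply Set.Subset.antisymm
  · rintro a ⟨s, hs, hfin, has⟩
    by_contra haA
    obtain ⟨A₀, hA₀, hdef⟩ := Set.definable_iff_finitely_definable.1 hs
    obtain ⟨φ, hφ⟩ := Set.definable_iff_exists_formula_sum.1 hdef
    let e := A₀.equivFin
    let φ' : L.Formula (Fin A₀.card ⊕ Fin 1) := φ.relabel (Sum.map e id)
    have key : ∀ x : N, φ'.Realize (Sum.elim (fun i => (e.symm i : N)) fun _ => x) ↔ x ∈ s := by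
      intro x
      have h1 : (fun _ => x : Fin 1 → N) ∈ {v : Fin 1 → N | v 0 ∈ s} ↔
          φ.Realize (Sum.elim (↑) (fun _ => x : Fin 1 → N)) := by
        rw [hφ]
        exact Iff.rfl
      refine Iff.trans ?_ h1.symm
      rw [Formula.realize_relabel]
      apply iff_of_eq
      congr 1
      funext i
      rcases i with i | i <;> simp
    have hinf := infinite_of_models_completeTheory hM hSAP N φ' (fun i => (e.symm i : N))
      ((key a).2 has) (by
        rintro i rfl
        exact haA (hA₀ (e.symm i).2))
    refine hinf (hfin.subset fun x hx => (key x).1 hx)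
  · intro a ha
    refine ⟨{a}, ?_, Set.finite_singleton a, rfl⟩
    refine Set.definable_iff_exists_formula_sum.2
      ⟨Term.equal (Term.var (Sum.inr 0)) (Term.var (Sum.inl ⟨a, ha⟩)), ?_⟩
    ext x
    simp [Formula.realize_equal]

/-- The theory of a Fraïssé limit of a class with strong amalgamation is geometric. -/
theorem isGeometric_of_strongAmalgamation (hM : IsFraisseLimit K M)
    (hSAP : StrongAmalgamation K) : IsGeometric.{u, v, w'} (L.completeTheory M) where
  eliminatesExistsInfinity := by
    intro n φ
    let φ' : L.Formula (Fin n ⊕ Fin 1) :=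
      φ.relabel (Fin.cons (Sum.inr 0) Sum.inl : Fin (n + 1) → Fin n ⊕ Fin 1)
    -- The formula `ψ(b)` asks for one solution outside `b`; conversely, an infinite set is not
    -- contained in the finite range of `b`.
    refine ⟨existsNotMem id id φ', fun N b => ?_⟩
    have key : ∀ x : N, φ'.Realize (Sum.elim b fun _ => x) ↔
        φ.Realize (Fin.cons x b : Fin (n + 1) → N) := by
      intro x
      rw [Formula.realize_relabel]
      apply iff_of_eq
      congr 1
      funext i
      refine Fin.cases ?_ (fun i => ?_) i <;> simp
    rw [realize_existsNotMem]
    simp only [← key]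
    constructor
    · rintro ⟨a, ha, hab⟩
      exact infinite_of_models_completeTheory hM hSAP N φ' b ha hab
    · intro hinf
      obtain ⟨a, ha, hab⟩ := hinf.exists_notMem_finite (Set.finite_range b)
      exact ⟨a, ha, fun i hi => hab ⟨i, hi.symm⟩⟩
  aclExchange := by
    intro N A a b ha hna
    rw [hasTrivialAcl_of_strongAmalgamation hM hSAP N] at ha hna ⊢
    rcases ha with ha | rfl
    · exact absurd ha hna
    · exact Or.inr rfl

end TrivialAcl

/-- The complement of the range of `f` is infinite, so it has room for the points of `B` outside the
range of `g`. -/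
theorem exists_injective_extension {A B Ω : Type*} [Finite B] [Infinite Ω] {g : A → B}
    (hg : Function.Injective g) {f : A → Ω} (hf : Function.Injective f) :
    ∃ k : B → Ω, Function.Injective k ∧ ∀ a, k (g a) = f a := by
  classical
  have : Finite A := Finite.of_injective g hg
  have : Infinite ↥(Set.range f)ᶜ := (Set.finite_range f).infinite_compl.to_subtype
  obtain ⟨n, ⟨e⟩⟩ := Finite.exists_equiv_fin B
  let i : B → ↥(Set.range f)ᶜ := fun b => Infinite.natEmbedding _ (e b : ℕ)
  have hi : Function.Injective i := fun b c h =>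
    e.injective (Fin.ext ((Infinite.natEmbedding _).injective h))
  have hfi : ∀ a b, f a ≠ i b := fun a b h => (i b).2 ⟨a, h⟩
  refine ⟨fun b => if h : ∃ a, g a = b then f h.choose else i b, ?_, ?_⟩
  · intro b c h
    by_cases hb : ∃ a, g a = b <;> by_cases hc : ∃ a, g a = c
    · simp only [dif_pos hb, dif_pos hc] at h
      rw [← hb.choose_spec, ← hc.choose_spec, hf h]
    · simp only [dif_pos hb, dif_neg hc] at h
      exact absurd h (hfi _ _)
    · simp only [dif_neg hb, dif_pos hc] at h
      exact absurd h.symm (hfi _ _)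
    · simp only [dif_neg hb, dif_neg hc] at h
      exact hi (Subtype.ext h)
  · intro a
    have h : ∃ a', g a' = g a := ⟨a, rfl⟩
    simp only [dif_pos h]
    rw [hg h.choose_spec]

/-! ### Fraïssé limits as unions of generic ideals -/

section FraisseLimit

variable {L : FirstOrder.Language.{u, v}}

/-- A member of the class `K` whose universe is a finite subset of `Ω`. -/
structure FinsetStructure (K : Set (Bundled.{w} L.Structure)) (Ω : Type w) where
  carrier : Finset Ω
  str : L.Structure carrier
  mem : Bundled.mk carrier str ∈ K

variable [L.IsRelational] {K : Set (Bundled.{w} L.Structure)} {Ω : Type w}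

namespace FinsetStructure

theorem countable [Finite (Σ n, L.Relations n)] [Countable Ω] :
    Countable (FinsetStructure K Ω) := by
  have : ∀ F : Finset Ω, Finite (L.Structure F) := fun F => finite_relationalStructure F
  refine Function.Injective.countable
    (f := fun p : FinsetStructure K Ω => (⟨p.carrier, p.str⟩ : Σ F : Finset Ω, L.Structure F)) ?_
  rintro ⟨F, S, hS⟩ ⟨G, T, hT⟩ h
  simp only [Sigma.mk.injEq] at h
  obtain ⟨rfl, h⟩ := h
  obtain rfl := eq_of_heq h
  rfl

/-- Extension of structures. -/
instance : Preorder (FinsetStructure K Ω) where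
  le p q := ∃ h : p.carrier ⊆ q.carrier,
    comapStructure (fun x : p.carrier => (⟨x, h x.2⟩ : q.carrier)) q.str = p.str
  le_refl p := ⟨Finset.Subset.refl _, comapStructure_id p.str⟩
  le_trans p q r := by
    rintro ⟨h, h'⟩ ⟨k, k'⟩
    refine ⟨h.trans k, ?_⟩
    rw [← h', ← k']
    rfl

theorem le_of_comapStructure {p q : FinsetStructure K Ω} (k : p.carrier → q.carrier)
    (hk : ∀ x, (k x : Ω) = x) (h : comapStructure k q.str = p.str) : p ≤ q := by
  refine ⟨fun x hx => by simpa only [hk] using (k ⟨x, hx⟩).2, ?_⟩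
  rw [← h]
  congr 1
  funext x
  exact Subtype.ext (hk x).symm

/-- Every member of `K` containing a copy of a finite subset of `Ω` is isomorphic over that subset to
one with universe in `Ω`. -/
theorem exists_of_mem [Infinite Ω] (hK : IsFraisse K) {A B : Type w} {T : L.Structure B}
    (hT : Bundled.mk B T ∈ K) {g : A → B} (hg : Function.Injective g) {f : A → Ω}
    (hf : Function.Injective f) :
    ∃ (q : FinsetStructure K Ω) (k : B ≃ q.carrier), (∀ a, (k (g a) : Ω) = f a) ∧
      comapStructure k q.str = T := by
  classical
  have : Finite B := finite_of_mem hK hT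
  obtain ⟨k, hk, hkg⟩ := exists_injective_extension hg hf
  let F : Finset Ω := (Set.finite_range k).toFinset
  let k' : B ≃ F := (Equiv.ofInjective k hk).trans
    (Equiv.subtypeEquivRight fun x => by simp [F])
  have hk'inv : comapStructure k' (comapStructure k'.symm T) = T := by
    rw [comapStructure_comp, Equiv.symm_comp_self, comapStructure_id]
  refine ⟨⟨F, comapStructure k'.symm T, ?_⟩, k', hkg, hk'inv⟩
  exact mem_of_comapStructure hK hT k'.symm.injective rfl

theorem exists_amalgam (hK : IsFraisse K) {A B C : Type w} {R : L.Structure A}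
    {S : L.Structure B} {T : L.Structure C} (hR : Bundled.mk A R ∈ K) (hS : Bundled.mk B S ∈ K)
    (hT : Bundled.mk C T ∈ K) {e : A → B} (he : Function.Injective e)
    (he' : comapStructure e S = R) {f : A → C} (hf : Function.Injective f)
    (hf' : comapStructure f T = R) :
    ∃ (D : Type w) (U : L.Structure D) (g : B → D) (h : C → D), Bundled.mk D U ∈ K ∧
      Function.Injective g ∧ Function.Injective h ∧ comapStructure g U = S ∧
      comapStructure h U = T ∧ ∀ a, g (e a) = h (f a) := by
  obtain ⟨⟨D, U⟩, g, h, hD, hgh⟩ := hK.amalgamation ⟨A, R⟩ ⟨B, S⟩ ⟨C, T⟩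
    (embeddingOfComap e he he') (embeddingOfComap f hf hf') hR hS hT
  exact ⟨D, U, g, h, hD, g.toEmbedding.injective, h.toEmbedding.injective,
    comapStructure_embedding g, comapStructure_embedding h, fun a => DFunLike.congr_fun hgh a⟩

/-- The structures that either realize the extension `p ≤ q`, or are incompatible with `p`. -/
def realizing (p q : FinsetStructure K Ω) : Set (FinsetStructure K Ω) :=
  {r | (∃ k : q.carrier → r.carrier, Function.Injective k ∧ comapStructure k r.str = q.str ∧
      ∀ x : q.carrier, (x : Ω) ∈ p.carrier → (k x : Ω) = x) ∨ ¬ ∃ s, r ≤ s ∧ p ≤ s}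

/-- If `r` and `p` have a common extension `s`, amalgamate `s` with `q` over `p` and name the result
in `Ω`, keeping the names of `s`. The new points of `q` may be renamed, which is why only the points
of `p` are fixed. Otherwise `r` itself is in the set. -/
theorem isCofinal_realizing [Infinite Ω] (hK : IsFraisse K) {p q : FinsetStructure K Ω}
    (hpq : p ≤ q) : IsCofinal (realizing p q) := by
  intro r
  by_cases hr : ∃ s, r ≤ s ∧ p ≤ s
  · obtain ⟨s, hrs, hps⟩ := hr
    obtain ⟨hq, hq'⟩ := hpq
    obtain ⟨hs, hs'⟩ := hps
    obtain ⟨D, U, g, h, hD, hg, hh, hgU, hhU, hgh⟩ := exists_amalgam hK p.mem s.mem q.mem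
      (fun x y h => Subtype.ext (congrArg (fun z : s.carrier => (z : Ω)) h)) hs'
      (fun x y h => Subtype.ext (congrArg (fun z : q.carrier => (z : Ω)) h)) hq'
    obtain ⟨t, k, hkg, hkT⟩ := exists_of_mem hK hD hg
      (f := fun x : s.carrier => (x : Ω)) Subtype.val_injective
    refine ⟨t, Or.inl ⟨fun x => k (h x), k.injective.comp hh, comapStructure_trans hhU hkT, ?_⟩,
      hrs.trans (le_of_comapStructure (fun x => k (g x)) hkg (comapStructure_trans hgU hkT))⟩
    intro x hx
    have h2 := hkg ⟨x, hs hx⟩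
    rw [hgh ⟨x, hx⟩] at h2
    exact h2
  · exact ⟨r, Or.inr hr, le_rfl⟩

/-- The union of an ideal of finite structures. -/
abbrev IdealUnion (I : Order.Ideal (FinsetStructure K Ω)) : Type w :=
  {x : Ω // ∃ r ∈ I, x ∈ r.carrier}

instance (I : Order.Ideal (FinsetStructure K Ω)) : L.Structure (IdealUnion I) where
  funMap := fun F _ => isEmptyElim F
  RelMap := fun R x => ∃ r ∈ I, ∃ h : ∀ i, (x i : Ω) ∈ r.carrier,
    r.str.RelMap R fun i => ⟨x i, h i⟩

/-- The inclusion of a member of an ideal into the union. -/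
def toUnion {I : Order.Ideal (FinsetStructure K Ω)} {r : FinsetStructure K Ω} (hr : r ∈ I)
    (x : r.carrier) : IdealUnion I :=
  ⟨x, r, hr, x.2⟩

theorem toUnion_injective {I : Order.Ideal (FinsetStructure K Ω)} {r : FinsetStructure K Ω}
    (hr : r ∈ I) : Function.Injective (toUnion hr) := fun _ _ h =>
  Subtype.ext (congrArg (fun y : IdealUnion I => (y : Ω)) h)

/-- A relation of the union may be witnessed in another member of the ideal; directedness compares
both members in a common extension. -/
theorem comapStructure_toUnion {I : Order.Ideal (FinsetStructure K Ω)} {r : FinsetStructure K Ω}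
    (hr : r ∈ I) : comapStructure (toUnion hr) inferInstance = r.str := by
  refine relationalStructure_ext fun n R x => ⟨?_, fun h => ⟨r, hr, fun i => (x i).2, h⟩⟩
  rintro ⟨s, hs, h, hR⟩
  obtain ⟨t, -, ⟨hrt, hrt'⟩, ⟨hst, hst'⟩⟩ := I.directed r hr s hs
  rw [← hst'] at hR
  rw [← hrt']
  exact hR

theorem exists_mem_of_finite (I : Order.Ideal (FinsetStructure K Ω)) {F : Set (IdealUnion I)}
    (hF : F.Finite) : ∃ r ∈ I, ∀ x ∈ F, (x : Ω) ∈ r.carrier := by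
  induction F, hF using Set.Finite.induction_on with
  | empty =>
    obtain ⟨r, hr⟩ := I.nonempty
    exact ⟨r, hr, fun x hx => absurd hx (Set.notMem_empty x)⟩
  | insert _ _ ih =>
    rename_i a F _ _
    obtain ⟨r, hr, hrF⟩ := ih
    obtain ⟨s, hs, has⟩ := a.2
    obtain ⟨t, ht, hrt, hst⟩ := I.directed r hr s hs
    refine ⟨t, ht, ?_⟩
    rintro x (rfl | hx)
    · exact hst.1 has
    · exact hrt.1 (hrF x hx)

/-- An ideal meeting all the sets of structures realizing an extension has a union into which all
extensions in `K` of its finite substructures embed. -/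
theorem exists_extension [Infinite Ω] (hK : IsFraisse K) {I : Order.Ideal (FinsetStructure K Ω)}
    (hI : ∀ p q : FinsetStructure K Ω, p ≤ q → ∃ r ∈ I, r ∈ realizing p q)
    {A B : Type w} {S₀ : L.Structure A} {T : L.Structure B} (hT : Bundled.mk B T ∈ K)
    (f : A ↪[L] IdealUnion I) (g : A ↪[L] B) :
    ∃ h : B ↪[L] IdealUnion I, ∀ a, h (g a) = f a := by
  classical
  have : Finite B := finite_of_mem hK hT
  have : Finite A := Finite.of_injective g g.injective
  obtain ⟨r, hr, hrf⟩ := exists_mem_of_finite I (Set.finite_range f)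
  obtain ⟨q, k, hkg, hkT⟩ := exists_of_mem hK hT g.injective
    (f := fun a => (f a : Ω)) (Subtype.val_injective.comp f.injective)
  let F : Finset Ω := (Set.finite_range fun a => (f a : Ω)).toFinset
  have hF : ∀ x, x ∈ F ↔ ∃ a, (f a : Ω) = x := fun x => by simp [F]
  have hFr : F ⊆ r.carrier := fun x hx => by
    obtain ⟨a, rfl⟩ := (hF x).1 hx
    exact hrf _ ⟨a, rfl⟩
  have hFq : ∀ x : F, ∃ a : A, (f a : Ω) = x := fun x => (hF x).1 x.2
  choose a ha using hFq
  -- The condition `p` is the image of `f` with the structure induced from `r`, and `q` is a copy of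
  -- `B` over it.
  let S : L.Structure F := comapStructure (fun x : F => (⟨x, hFr x.2⟩ : r.carrier)) r.str
  let p : FinsetStructure K Ω := ⟨F, S, mem_of_comapStructure hK r.mem
    (fun x y h => Subtype.ext (by simpa using h)) rfl⟩
  have hpr : p ≤ r := ⟨hFr, rfl⟩
  have hpq : p ≤ q := by
    refine le_of_comapStructure (fun x => k (g (a x))) (fun x => (hkg _).trans (ha x)) ?_
    have h1 : comapStructure (fun x : F => k (g (a x))) q.str =
        comapStructure a S₀ :=
      congrArg (comapStructure a) (comapStructure_trans (comapStructure_embedding g) hkT)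
    have h2 : comapStructure a S₀ =
        comapStructure (fun x : F => f (a x)) inferInstance :=
      congrArg (comapStructure a) (comapStructure_embedding f).symm
    refine h1.trans (h2.trans ?_)
    change _ = comapStructure (fun x : F => (⟨x, hFr x.2⟩ : r.carrier)) r.str
    rw [← comapStructure_toUnion hr, comapStructure_comp]
    congr 1
    funext x
    exact Subtype.ext (ha x)
  obtain ⟨s, hs, hs'⟩ := hI p q hpq
  obtain ⟨t, -, hrt, hst⟩ := I.directed r hr s hs
  -- Incompatibility with `p` is excluded, since `t` extends both `s` and `p`.
  obtain ⟨j, hj, hjq, hjp⟩ := hs'.resolve_right fun h => h ⟨t, hst, hpr.trans hrt⟩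
  refine ⟨embeddingOfComap (fun b => toUnion hs (j (k b)))
    ((toUnion_injective hs).comp (hj.comp k.injective)) ?_, fun a => ?_⟩
  · rw [← hkT, ← hjq, ← comapStructure_toUnion hs]
    rfl
  · apply Subtype.ext
    change (j (k (g a)) : Ω) = _
    rw [hjp _ ((hF _).2 ⟨a, (hkg a).symm⟩), hkg]

end FinsetStructure

open FinsetStructure in
/-- Existence of Fraïssé limits for finite relational languages. -/
theorem exists_isFraisseLimit [Finite (Σ n, L.Relations n)] (hK : IsFraisse K) :
    ∃ (N : Type w) (_ : L.Structure N) (_ : Countable N), IsFraisseLimit K N := by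
  let Ω : Type w := ULift.{w} ℕ
  have : Countable (FinsetStructure K Ω) := FinsetStructure.countable
  -- There are only countably many extension problems, so one ideal can meet all the corresponding
  -- cofinal sets.
  let _ : Encodable {pq : FinsetStructure K Ω × FinsetStructure K Ω // pq.1 ≤ pq.2} :=
    Encodable.ofCountable _
  obtain ⟨⟨A, S⟩, hA⟩ := hK.is_nonempty
  obtain ⟨p₀, -⟩ := exists_of_mem (Ω := Ω) hK hA (g := (PEmpty.elim : PEmpty.{w + 1} → A))
    (fun x => x.elim) (f := PEmpty.elim) (fun x => x.elim)
  let I : Order.Ideal (FinsetStructure K Ω) := Order.idealOfCofinals p₀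
    fun pq : {pq : FinsetStructure K Ω × FinsetStructure K Ω // pq.1 ≤ pq.2} =>
      (⟨realizing pq.1.1 pq.1.2, isCofinal_realizing hK pq.2⟩ : Order.Cofinal _)
  have hI : ∀ p q : FinsetStructure K Ω, p ≤ q → ∃ r ∈ I, r ∈ realizing p q := by
    intro p q hpq
    obtain ⟨r, hr, hrI⟩ := Order.cofinal_meets_idealOfCofinals p₀
      (fun pq : {pq : FinsetStructure K Ω × FinsetStructure K Ω // pq.1 ≤ pq.2} =>
        (⟨realizing pq.1.1 pq.1.2, isCofinal_realizing hK pq.2⟩ : Order.Cofinal _)) ⟨(p, q), hpq⟩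
    exact ⟨r, hrI, hr⟩
  have hage : ∀ (B : Type w) (T : L.Structure B), Finite B → (B ↪[L] IdealUnion I) →
      Bundled.mk B T ∈ K := by
    intro B T _ e
    obtain ⟨r, hr, hre⟩ := exists_mem_of_finite I (Set.finite_range e)
    refine mem_of_comapStructure hK r.mem (f := fun b => ⟨e b, hre _ ⟨b, rfl⟩⟩)
      (fun b c h => e.injective (Subtype.ext (by simpa using h))) ?_
    rw [← comapStructure_toUnion hr, comapStructure_comp]
    exact comapStructure_embedding e
  refine ⟨IdealUnion I, inferInstance, inferInstance, ?_, ?_⟩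
  · rw [isUltrahomogeneous_iff_IsExtensionPair (Structure.cg_of_countable)]
    rintro ⟨f, hf⟩ m
    let S := f.dom ⊔ Substructure.closure L {m}
    have hS : S.FG := hf.sup (Substructure.fg_closure_singleton _)
    have hSK : (Bundled.mk S inferInstance : Bundled L.Structure) ∈ K :=
      hage S _ hS.finite S.subtype
    obtain ⟨g, hg⟩ := exists_extension hK hI hSK
      (f.cod.subtype.comp f.toEquiv.toEmbedding)
      (Substructure.inclusion (le_sup_left : f.dom ≤ S))
    refine ⟨⟨⟨S, g.toHom.range, g.equivRange⟩, hS⟩,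
      Substructure.subset_closure.trans (le_sup_right : _ ≤ S) (Set.mem_singleton m),
      ⟨le_sup_left, ?_⟩⟩
    exact Embedding.ext hg
  · ext ⟨B, T⟩
    constructor
    · rintro ⟨hfg, ⟨e⟩⟩
      exact hage B T (Structure.FG.finite hfg) e
    · intro hB
      refine ⟨hK.FG _ hB, ?_⟩
      -- The empty substructure still carries the values of nullary relations, so `B` is compared
      -- with it by joint embedding.
      let E : L.Substructure (IdealUnion I) := ⊥
      have hE : (Bundled.mk E inferInstance : Bundled L.Structure) ∈ K :=
        hage E _ (Substructure.fg_bot.finite) E.subtype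
      obtain ⟨D, hD, ⟨e⟩, ⟨f⟩⟩ := hK.jointEmbedding _ hE _ hB
      obtain ⟨h, -⟩ := exists_extension hK hI hD E.subtype e
      exact ⟨h.comp f⟩

end FraisseLimit

/-! ### Strong amalgamation on pushouts of sets -/

/-- The pushout of two injections, with its characteristic properties. -/
theorem exists_pushout {X Y Z : Type w} {f : X → Y} (hf : Function.Injective f) {g : X → Z}
    (hg : Function.Injective g) :
    ∃ (P : Type w) (i : Y → P) (j : Z → P), Function.Injective i ∧ Function.Injective j ∧
      (∀ x, i (f x) = j (g x)) ∧ (∀ y z, i y = j z → ∃ x, f x = y ∧ g x = z) ∧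
      ∀ p, (∃ y, i y = p) ∨ ∃ z, j z = p := by
  classical
  let j : Z → Y ⊕ {z : Z // ¬ ∃ x, g x = z} := fun z =>
    if h : ∃ x, g x = z then Sum.inl (f h.choose) else Sum.inr ⟨z, h⟩
  have hjg : ∀ x, j (g x) = Sum.inl (f x) := by
    intro x
    have h : ∃ x', g x' = g x := ⟨x, rfl⟩
    simp only [j, dif_pos h]
    rw [hg h.choose_spec]
  have hj : ∀ (z : Z) (h : ¬ ∃ x, g x = z), j z = Sum.inr ⟨z, h⟩ := fun z h => dif_neg h
  refine ⟨Y ⊕ {z : Z // ¬ ∃ x, g x = z}, Sum.inl, j, Sum.inl_injective, ?_,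
    fun x => (hjg x).symm, ?_, ?_⟩
  · intro z z' h
    by_cases hz : ∃ x, g x = z <;> by_cases hz' : ∃ x, g x = z'
    · obtain ⟨x, rfl⟩ := hz
      obtain ⟨x', rfl⟩ := hz'
      rw [hjg, hjg] at h
      rw [hf (Sum.inl_injective h)]
    · obtain ⟨x, rfl⟩ := hz
      rw [hjg, hj _ hz'] at h
      cases h
    · obtain ⟨x', rfl⟩ := hz'
      rw [hjg, hj _ hz] at h
      cases h
    · rw [hj _ hz, hj _ hz'] at h
      exact congrArg Subtype.val (Sum.inr_injective h)
  · intro y z h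
    by_cases hz : ∃ x, g x = z
    · obtain ⟨x, rfl⟩ := hz
      rw [hjg] at h
      exact ⟨x, (Sum.inl_injective h).symm, rfl⟩
    · rw [hj _ hz] at h
      cases h
  · rintro (y | z)
    · exact Or.inl ⟨y, rfl⟩
    · exact Or.inr ⟨z, hj _ z.2⟩

theorem finite_of_jointly_surjective {Y Z P : Type*} [Finite Y] [Finite Z] {i : Y → P} {j : Z → P}
    (h : ∀ p, (∃ y, i y = p) ∨ ∃ z, j z = p) : Finite P := by
  refine Finite.of_surjective (Sum.elim i j) fun p => ?_
  rcases h p with ⟨y, hy⟩ | ⟨z, hz⟩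
  · exact ⟨Sum.inl y, hy⟩
  · exact ⟨Sum.inr z, hz⟩

section Amalgam

variable {L : FirstOrder.Language.{u, v}} [L.IsRelational] {K : Set (Bundled.{w} L.Structure)}

/-- Strong amalgamation can be carried out on the pushout of the underlying sets. -/
theorem exists_structure_on_pushout (hK : IsFraisse K) (hSAP : StrongAmalgamation K)
    {X Y Z P : Type w} {f : X → Y} (hf : Function.Injective f) {g : X → Z}
    (hg : Function.Injective g) {i : Y → P} {j : Z → P} (hij : ∀ x, i (f x) = j (g x))
    (hinter : ∀ y z, i y = j z → ∃ x, f x = y ∧ g x = z) (hi : Function.Injective i)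
    (hj : Function.Injective j) (hcover : ∀ p, (∃ y, i y = p) ∨ ∃ z, j z = p)
    {S : L.Structure Y} (hS : Bundled.mk Y S ∈ K) {T : L.Structure Z} (hT : Bundled.mk Z T ∈ K)
    (hST : comapStructure f S = comapStructure g T) :
    ∃ U : L.Structure P, Bundled.mk P U ∈ K ∧ comapStructure i U = S ∧ comapStructure j U = T := by
  have : Finite Y := finite_of_mem hK hS
  have : Finite Z := finite_of_mem hK hT
  have : Finite X := Finite.of_injective f hf
  have : Finite P := finite_of_jointly_surjective hcover
  let R : L.Structure X := comapStructure f S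
  have hR : Bundled.mk X R ∈ K := mem_of_comapStructure hK hS hf rfl
  obtain ⟨⟨D, V⟩, hD, d, e, hde, hrange⟩ := hSAP ⟨X, R⟩ ⟨Y, S⟩ ⟨Z, T⟩ hR hS hT
    (embeddingOfComap f hf rfl) (embeddingOfComap g hg hST.symm)
  have hdi : Function.Injective d := d.toEmbedding.injective
  have hei : Function.Injective e := e.toEmbedding.injective
  have hde' : ∀ x, d (f x) = e (g x) := fun x => DFunLike.congr_fun hde x
  have hinter' : ∀ y z, d y = e z → ∃ x, f x = y ∧ g x = z := by
    intro y z h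
    have hmem : d y ∈ Set.range d ∩ Set.range e := ⟨⟨y, rfl⟩, ⟨z, h.symm⟩⟩
    rw [hrange] at hmem
    obtain ⟨x, hx⟩ := hmem
    have hx' : d (f x) = d y := hx
    refine ⟨x, hdi hx', hei ?_⟩
    rw [← hde', hx', h]
  -- The amalgam `D` may have extra points. The pushout maps to it by `ψ`, which is injective
  -- because the images of `d` and `e` meet only in that of `X`; the structure is pulled back along
  -- `ψ`.
  have hψ : ∀ p : P, ∃ c : D, (∀ y, i y = p → d y = c) ∧ ∀ z, j z = p → e z = c := by
    intro p
    rcases hcover p with ⟨y, rfl⟩ | ⟨z, rfl⟩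
    · refine ⟨d y, fun y' h => by rw [hi h], fun z h => ?_⟩
      obtain ⟨x, rfl, rfl⟩ := hinter y z h.symm
      exact (hde' x).symm
    · refine ⟨e z, fun y h => ?_, fun z' h => by rw [hj h]⟩
      obtain ⟨x, rfl, rfl⟩ := hinter y z h
      exact hde' x
  choose ψ hψi hψj using hψ
  have hψi' : ∀ y, ψ (i y) = d y := fun y => (hψi _ y rfl).symm
  have hψj' : ∀ z, ψ (j z) = e z := fun z => (hψj _ z rfl).symm
  have hψinj : Function.Injective ψ := by
    intro p q h
    rcases hcover p with ⟨y, rfl⟩ | ⟨z, rfl⟩ <;> rcases hcover q with ⟨y', rfl⟩ | ⟨z', rfl⟩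
    · rw [hψi', hψi'] at h
      rw [hdi h]
    · rw [hψi', hψj'] at h
      obtain ⟨x, rfl, rfl⟩ := hinter' _ _ h
      exact hij x
    · rw [hψi', hψj'] at h
      obtain ⟨x, rfl, rfl⟩ := hinter' _ _ h.symm
      exact (hij x).symm
    · rw [hψj', hψj'] at h
      rw [hei h]
  refine ⟨comapStructure ψ V, mem_of_comapStructure hK hD hψinj rfl, ?_, ?_⟩
  · rw [comapStructure_comp, show ψ ∘ i = d from funext hψi']
    exact comapStructure_embedding d
  · rw [comapStructure_comp, show ψ ∘ j = e from funext hψj']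
    exact comapStructure_embedding e

/-- A member of an age of an infinite structure extends to any larger finite universe. -/
theorem exists_extension_to_finite {M : Type w} [L.Structure M] [Infinite M] (hM : L.age M = K)
    {A C : Type w} [Finite C] {f : A → C} (hf : Function.Injective f) {S : L.Structure A}
    (hS : Bundled.mk A S ∈ K) :
    ∃ T : L.Structure C, Bundled.mk C T ∈ K ∧ comapStructure f T = S := by
  rw [← hM] at hS
  obtain ⟨-, ⟨e⟩⟩ := hS
  -- A copy of `A` in `M` is enlarged by arbitrary points of the infinite `M`, and `C` inherits the
  -- induced structure.
  obtain ⟨k, hk, hkf⟩ := exists_injective_extension hf e.toEmbedding.injective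
  refine ⟨comapStructure k inferInstance, ?_, ?_⟩
  · rw [← hM]
    exact ⟨(@Structure.fg_iff_finite L C (comapStructure k inferInstance) _).2 ‹_›,
      ⟨embeddingOfComap k hk rfl⟩⟩
  · rw [comapStructure_comp, show k ∘ f = e from funext hkf]
    exact comapStructure_embedding e

end Amalgam

/-! ### The two-sorted class -/

section Pfc

variable {L : FirstOrder.Language.{u, v}}

theorem pfcStructure_relMap_rel {A B : Type w} {S : B → L.Structure A} {n : ℕ}
    (R : L.Relations n) (b : B) (a : Fin n → A) :
    (pfcStructure S).RelMap (PfcRelations.rel R : (pfcLanguage L).Relations (n + 1))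
      (Fin.cons (Sum.inr b) fun i => Sum.inl (a i)) ↔ (S b).RelMap R a := by
  constructor
  · rintro ⟨b', a', h, hR⟩
    obtain ⟨hb, ha⟩ := Fin.cons_injective2 h
    obtain rfl := Sum.inr_injective hb
    have : a = a' := funext fun i => Sum.inl_injective (congrFun ha i)
    rwa [this]
  · intro h
    exact ⟨b, a, rfl, h⟩

theorem finite_pfcRelations [Finite (Σ n, L.Relations n)] :
    Finite (Σ n, (pfcLanguage L).Relations n) := by
  refine Finite.of_surjective
    (fun x : Option (Option (Σ n, L.Relations n)) =>
      (match x with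
      | none => ⟨1, PfcRelations.sortO⟩
      | some none => ⟨1, PfcRelations.sortP⟩
      | some (some R) => ⟨R.1 + 1, PfcRelations.rel R.2⟩ : Σ n, PfcRelations L n)) ?_
  rintro ⟨n, R⟩
  cases R with
  | sortO => exact ⟨none, rfl⟩
  | sortP => exact ⟨some none, rfl⟩
  | rel R => exact ⟨some (some ⟨_, R⟩), rfl⟩

theorem pfcClass_finite {K : Set (Bundled.{w} L.Structure)}
    {X : Bundled.{w} (pfcLanguage L).Structure} (hX : X ∈ pfcClass K) :
    Finite X := by
  obtain ⟨A, B, S, hA, hB, -, ⟨i⟩⟩ := hX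
  exact Finite.of_equiv _ (@Language.Equiv.toEquiv _ _ _ X.str (pfcStructure S) i).symm

theorem mem_pfcClass_iff {K : Set (Bundled.{w} L.Structure)} (hK : IsFraisse K)
    {X : Type w} {T : (pfcLanguage L).Structure X} :
    Bundled.mk X T ∈ pfcClass K ↔ ∃ (A B : Type w) (S : B → L.Structure A), Finite A ∧ Finite B ∧
      (∀ b, Bundled.mk A (S b) ∈ K) ∧
      ∃ i : X ≃ A ⊕ B, comapStructure i (pfcStructure S) = T := by
  constructor
  · rintro ⟨A, B, S, hA, hB, hS, ⟨i⟩⟩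
    refine ⟨A, B, S, hA, hB, fun b => ?_, @Language.Equiv.toEquiv _ _ _ T (pfcStructure S) i,
      @comapStructure_equiv (pfcLanguage L) _ _ _ T (pfcStructure S) i⟩
    obtain ⟨D, hD, ⟨e⟩⟩ := hS b
    exact (hK.is_equiv_invariant (M := ⟨A, S b⟩) (N := D) ⟨e⟩).2 hD
  · rintro ⟨A, B, S, hA, hB, hS, i, hi⟩
    exact ⟨A, B, S, hA, hB, fun b => ⟨_, hS b, ⟨@Language.Equiv.refl L A (S b)⟩⟩,
      ⟨@equivOfComap (pfcLanguage L) _ _ _ T (pfcStructure S) i hi⟩⟩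

variable [L.IsRelational]

theorem comapStructure_sumMap {A B A' B' : Type w} {S : B → L.Structure A}
    {S' : B' → L.Structure A'} {α : A → A'} {β : B → B'}
    (h : ∀ b, comapStructure α (S' (β b)) = S b) :
    comapStructure (Sum.map α β) (pfcStructure S') = pfcStructure S := by
  refine relationalStructure_ext fun n R x => ?_
  cases R with
  | sortO =>
    change (∃ a', Sum.map α β (x 0) = Sum.inl a') ↔ ∃ a, x 0 = Sum.inl a
    rcases x 0 with a | b <;> simp
  | sortP =>
    change (∃ b', Sum.map α β (x 0) = Sum.inr b') ↔ ∃ b, x 0 = Sum.inr b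
    rcases x 0 with a | b <;> simp
  | rel R =>
    constructor
    · rintro ⟨b', a', hx, hR⟩
      have h0 : Sum.map α β (x 0) = Sum.inr b' := congrFun hx 0
      have hs : ∀ i, Sum.map α β (x (Fin.succ i)) = Sum.inl (a' i) := fun i => congrFun hx i.succ
      have h0' : ∃ b, x 0 = Sum.inr b ∧ β b = b' := by
        rcases hx0 : x 0 with a | b
        · rw [hx0] at h0
          cases h0
        · rw [hx0] at h0
          exact ⟨b, rfl, Sum.inr_injective h0⟩
      have hs' : ∀ i, ∃ a, x (Fin.succ i) = Sum.inl a ∧ α a = a' i := by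
        intro i
        have := hs i
        rcases hxi : x (Fin.succ i) with a | b
        · rw [hxi] at this
          exact ⟨a, rfl, Sum.inl_injective this⟩
        · rw [hxi] at this
          cases this
      obtain ⟨b, hb, rfl⟩ := h0'
      choose a ha ha' using hs'
      refine ⟨b, a, ?_, ?_⟩
      · funext i
        exact Fin.cases hb ha i
      · rw [← h b]
        change (S' (β b)).RelMap R (α ∘ a)
        rwa [show α ∘ a = a' from funext ha']
    · rintro ⟨b, a, rfl, hR⟩
      rw [← h b] at hR
      refine ⟨β b, α ∘ a, ?_, hR⟩
      funext i
      exact Fin.cases rfl (fun _ => rfl) i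

/-- The sorts are predicates of the language, so a structure-inducing map respects them; evaluating
`R_x` at `x = b` then recovers the structure attached to `b`. -/
theorem exists_eq_sumMap {A B A' B' : Type w} {S : B → L.Structure A}
    {S' : B' → L.Structure A'} {e : A ⊕ B → A' ⊕ B'}
    (h : comapStructure e (pfcStructure S') = pfcStructure S) :
    ∃ (α : A → A') (β : B → B'), e = Sum.map α β ∧
      ∀ b, comapStructure α (S' (β b)) = S b := by
  have hrel : ∀ (n : ℕ) (R : (pfcLanguage L).Relations n) (x : Fin n → A ⊕ B),
      (pfcStructure S').RelMap R (e ∘ x) ↔ (pfcStructure S).RelMap R x := by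
    intro n R x
    rw [← h]
    exact Iff.rfl
  have hO : ∀ a, ∃ a', e (Sum.inl a) = Sum.inl a' := fun a =>
    (hrel 1 PfcRelations.sortO fun _ => Sum.inl a).2 ⟨a, rfl⟩
  have hP : ∀ b, ∃ b', e (Sum.inr b) = Sum.inr b' := fun b =>
    (hrel 1 PfcRelations.sortP fun _ => Sum.inr b).2 ⟨b, rfl⟩
  choose α hα using hO
  choose β hβ using hP
  refine ⟨α, β, ?_, fun b => ?_⟩
  · funext x
    rcases x with a | b
    · exact hα a
    · exact hβ b
  · refine relationalStructure_ext fun n R x => ?_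
    refine Iff.trans ?_ ((hrel _ _ _).trans (pfcStructure_relMap_rel R b x))
    have : (e ∘ Fin.cons (Sum.inr b) fun i => Sum.inl (x i) : Fin (n + 1) → A' ⊕ B') =
        Fin.cons (Sum.inr (β b)) fun i => Sum.inl (α (x i)) := by
      funext i
      exact Fin.cases (hβ b) (fun i => hα (x i)) i
    rw [this]
    exact (pfcStructure_relMap_rel R (β b) fun i => α (x i)).symm

variable {K : Set (Bundled.{w} L.Structure)}

/-- A substructure splits by sort, and each surviving `b` carries a restriction of a member of `K`.
-/
theorem pfcClass_hereditary (hK : IsFraisse K) : Hereditary (pfcClass K) := by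
  rintro ⟨X, T⟩ hX ⟨Y, U⟩ ⟨hfg, ⟨e⟩⟩
  have : Finite Y := Structure.FG.finite hfg
  obtain ⟨A, B, S, hA, hB, hS, i, hi⟩ := (mem_pfcClass_iff hK).1 hX
  let f : Y → A ⊕ B := fun y => i (e y)
  have hf : Function.Injective f := i.injective.comp e.toEmbedding.injective
  have hfU : comapStructure f (pfcStructure S) = U :=
    comapStructure_trans (comapStructure_embedding e) hi
  let A₀ : Type w := {y : Y // ∃ a, f y = Sum.inl a}
  let B₀ : Type w := {y : Y // ¬ ∃ a, f y = Sum.inl a}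
  have hα : ∀ y : A₀, ∃ a, f y = Sum.inl a := fun y => y.2
  have hβ : ∀ y : B₀, ∃ b, f y = Sum.inr b := by
    intro y
    rcases h : f y with a | b
    · exact absurd ⟨a, h⟩ y.2
    · exact ⟨b, rfl⟩
  choose α hα using hα
  choose β hβ using hβ
  have hαinj : Function.Injective α := fun x y h =>
    Subtype.ext (hf (by rw [hα, hα, h]))
  classical
  let j : A₀ ⊕ B₀ ≃ Y := Equiv.sumCompl _
  have hj : f ∘ j = Sum.map α β := by
    funext x
    rcases x with x | x
    · exact hα x
    · exact hβ x
  refine (mem_pfcClass_iff hK).2 ⟨A₀, B₀, fun b => comapStructure α (S (β b)), inferInstance,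
    inferInstance, fun b => mem_of_comapStructure hK (hS _) hαinj rfl, j.symm, ?_⟩
  rw [← comapStructure_sumMap (fun b => rfl), ← hj, comapStructure_comp, Function.comp_assoc,
    Equiv.self_comp_symm]
  exact hfU

/-- Classes of finite structures in a finite relational language are essentially countable. -/
theorem countable_quotient_of_finite {L : FirstOrder.Language.{u, v}} [L.IsRelational]
    [Finite (Σ n, L.Relations n)] {K : Set (Bundled.{w} L.Structure)}
    (hK : ∀ X ∈ K, Finite X) : (Quotient.mk' '' K).Countable := by
  have : ∀ n : ℕ, Finite (L.Structure (ULift.{w} (Fin n))) := fun n => finite_relationalStructure _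
  refine (Set.countable_range fun x : Σ n : ℕ, L.Structure (ULift.{w} (Fin n)) =>
    (Quotient.mk' (Bundled.mk _ x.2 : Bundled.{w} L.Structure))).mono ?_
  rintro _ ⟨⟨X, T⟩, hX, rfl⟩
  obtain ⟨n, ⟨e⟩⟩ := @Finite.exists_equiv_fin X (hK _ hX)
  let e' : ULift.{w} (Fin n) ≃ X := Equiv.ulift.trans e.symm
  exact ⟨⟨n, comapStructure e' T⟩,
    Quotient.sound ⟨@equivOfComap L _ _ _ (comapStructure e' T) T e' rfl⟩⟩

theorem pfcClass_strongAmalgamation (hK : IsFraisse K) (hSAP : StrongAmalgamation K)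
    {M : Type w} [L.Structure M] [Infinite M] (hM : L.age M = K) :
    StrongAmalgamation (pfcClass K) := by
  rintro ⟨X₁, T₁⟩ ⟨X₂, T₂⟩ ⟨X₃, T₃⟩ h₁ h₂ h₃ e f
  obtain ⟨A₁, B₁, S₁, hA₁, hB₁, hS₁, i₁, hi₁⟩ := (mem_pfcClass_iff hK).1 h₁
  obtain ⟨A₂, B₂, S₂, hA₂, hB₂, hS₂, i₂, hi₂⟩ := (mem_pfcClass_iff hK).1 h₂
  obtain ⟨A₃, B₃, S₃, hA₃, hB₃, hS₃, i₃, hi₃⟩ := (mem_pfcClass_iff hK).1 h₃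
  have hi₁' : comapStructure i₁.symm T₁ = pfcStructure S₁ := by
    rw [← hi₁, comapStructure_comp, Equiv.self_comp_symm, comapStructure_id]
  obtain ⟨α₂, β₂, he, hαβ₂⟩ := exists_eq_sumMap
    (comapStructure_trans (comapStructure_trans hi₁' (comapStructure_embedding e)) hi₂)
  obtain ⟨α₃, β₃, hf, hαβ₃⟩ := exists_eq_sumMap
    (comapStructure_trans (comapStructure_trans hi₁' (comapStructure_embedding f)) hi₃)
  have hinj₂ : Function.Injective (Sum.map α₂ β₂) := by
    rw [← he]
    exact i₂.injective.comp (e.toEmbedding.injective.comp i₁.symm.injective)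
  have hinj₃ : Function.Injective (Sum.map α₃ β₃) := by
    rw [← hf]
    exact i₃.injective.comp (f.toEmbedding.injective.comp i₁.symm.injective)
  rw [Sum.map_injective] at hinj₂ hinj₃
  obtain ⟨A, iA, jA, hiA, hjA, hijA, hinterA, hcoverA⟩ := exists_pushout hinj₂.1 hinj₃.1
  obtain ⟨B, iB, jB, hiB, hjB, hijB, hinterB, hcoverB⟩ := exists_pushout hinj₂.2 hinj₃.2
  have hA : Finite A := finite_of_jointly_surjective hcoverA
  have hB : Finite B := finite_of_jointly_surjective hcoverB
  have amalgam : ∀ {b₂ : L.Structure A₂} {b₃ : L.Structure A₃}, Bundled.mk A₂ b₂ ∈ K →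
      Bundled.mk A₃ b₃ ∈ K → comapStructure α₂ b₂ = comapStructure α₃ b₃ →
      ∃ U : L.Structure A, Bundled.mk A U ∈ K ∧ comapStructure iA U = b₂ ∧
        comapStructure jA U = b₃ := fun h h' h'' =>
    exists_structure_on_pushout hK hSAP hinj₂.1 hinj₃.1 hijA hinterA hiA hjA hcoverA h h' h''
  have hS : ∀ b : B, ∃ U : L.Structure A, Bundled.mk A U ∈ K ∧
      (∀ b₂, iB b₂ = b → comapStructure iA U = S₂ b₂) ∧
      ∀ b₃, jB b₃ = b → comapStructure jA U = S₃ b₃ := by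
    intro b
    by_cases hb₂ : ∃ b₂, iB b₂ = b <;> by_cases hb₃ : ∃ b₃, jB b₃ = b
    · obtain ⟨b₂, rfl⟩ := hb₂
      obtain ⟨b₃, hb₃⟩ := hb₃
      obtain ⟨b₁, rfl, rfl⟩ := hinterB _ _ hb₃.symm
      obtain ⟨U, hU, hU₂, hU₃⟩ := amalgam (hS₂ (β₂ b₁)) (hS₃ (β₃ b₁))
        ((hαβ₂ b₁).trans (hαβ₃ b₁).symm)
      exact ⟨U, hU, fun b₂ h => by rw [hU₂, hiB h], fun b₃ h => by rw [hU₃, hjB (h.trans hb₃.symm)]⟩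
    · obtain ⟨b₂, rfl⟩ := hb₂
      -- Here `b` prescribes nothing on `A₃`, so any extension to `A₃` of the restriction of `S₂ b₂`
      -- to `A₁` will do.
      obtain ⟨V, hV, hV'⟩ := exists_extension_to_finite hM hinj₃.1
        (mem_of_comapStructure hK (hS₂ b₂) hinj₂.1 rfl)
      obtain ⟨U, hU, hU₂, -⟩ := amalgam (hS₂ b₂) hV hV'.symm
      exact ⟨U, hU, fun b₂ h => by rw [hU₂, hiB h], fun b₃ h => absurd ⟨b₃, h⟩ hb₃⟩
    · obtain ⟨b₃, rfl⟩ := hb₃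
      obtain ⟨V, hV, hV'⟩ := exists_extension_to_finite hM hinj₂.1
        (mem_of_comapStructure hK (hS₃ b₃) hinj₃.1 rfl)
      obtain ⟨U, hU, -, hU₃⟩ := amalgam hV (hS₃ b₃) hV'
      exact ⟨U, hU, fun b₂ h => absurd ⟨b₂, h⟩ hb₂, fun b₃ h => by rw [hU₃, hjB h]⟩
    · exact absurd (hcoverB b) (by rintro (h | h); exacts [hb₂ h, hb₃ h])
  choose S hSK hSi hSj using hS
  have hemb₂ := comapStructure_trans hi₂ (comapStructure_sumMap fun b₂ => hSi _ b₂ rfl)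
  have hemb₃ := comapStructure_trans hi₃ (comapStructure_sumMap fun b₃ => hSj _ b₃ rfl)
  have he' : ∀ x, i₂ (e x) = Sum.map α₂ β₂ (i₁ x) := fun x => by
    rw [← he]
    simp
  have hf' : ∀ x, i₃ (f x) = Sum.map α₃ β₃ (i₁ x) := fun x => by
    rw [← hf]
    simp
  have hcomm : ∀ x, Sum.map iA iB (i₂ (e x)) = Sum.map jA jB (i₃ (f x)) := by
    intro x
    rw [he', hf']
    rcases i₁ x with a | b
    · exact congrArg Sum.inl (hijA a)
    · exact congrArg Sum.inr (hijB b)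
  let g := @embeddingOfComap (pfcLanguage L) _ _ _ T₂ (pfcStructure S) _
    ((Sum.map_injective.2 ⟨hiA, hiB⟩).comp i₂.injective) hemb₂
  let h := @embeddingOfComap (pfcLanguage L) _ _ _ T₃ (pfcStructure S) _
    ((Sum.map_injective.2 ⟨hjA, hjB⟩).comp i₃.injective) hemb₃
  refine ⟨⟨A ⊕ B, pfcStructure S⟩, (mem_pfcClass_iff hK).2
    ⟨A, B, S, hA, hB, hSK, Equiv.refl _, comapStructure_id _⟩, g, h, ?_, ?_⟩
  · exact @Embedding.ext (pfcLanguage L) _ _ T₁ (pfcStructure S) _ _ hcomm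
  · apply Set.Subset.antisymm
    · rintro _ ⟨⟨y, rfl⟩, ⟨z, hz⟩⟩
      have hz' : Sum.map jA jB (i₃ z) = Sum.map iA iB (i₂ y) := hz
      have key : ∃ x, Sum.map α₂ β₂ x = i₂ y := by
        clear hz
        revert hz'
        rcases i₂ y with a | b <;> rcases i₃ z with a' | b' <;> intro hz'
        · obtain ⟨x, hx, -⟩ := hinterA a a' (Sum.inl_injective hz').symm
          exact ⟨Sum.inl x, congrArg Sum.inl hx⟩
        · cases hz'
        · cases hz'
        · obtain ⟨x, hx, -⟩ := hinterB b b' (Sum.inr_injective hz').symm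
          exact ⟨Sum.inr x, congrArg Sum.inr hx⟩
      obtain ⟨x, hx⟩ := key
      refine ⟨i₁.symm x, ?_⟩
      have : e (i₁.symm x) = y := by
        apply i₂.injective
        rw [he', Equiv.apply_symm_apply, hx]
      exact congrArg g this
    · rintro _ ⟨x, rfl⟩
      exact ⟨⟨e x, rfl⟩, ⟨f x, (hcomm x).symm⟩⟩

/-- Joint embedding is amalgamation over the structure with both sorts empty. It belongs to the
class vacuously and embeds in every member, because `pfcLanguage L` has no nullary symbols. -/
theorem pfcClass_isFraisse [Finite (Σ n, L.Relations n)] (hK : IsFraisse K)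
    (hSAP : StrongAmalgamation (pfcClass K)) : IsFraisse (pfcClass K) := by
  have : Finite (Σ n, (pfcLanguage L).Relations n) := finite_pfcRelations
  obtain ⟨E, hE, emb⟩ : ∃ E ∈ pfcClass K, ∀ X ∈ pfcClass K, Nonempty (E ↪[pfcLanguage L] X) := by
    let S : PEmpty.{w + 1} → L.Structure PEmpty.{w + 1} := fun b => b.elim
    refine ⟨⟨PEmpty.{w + 1} ⊕ PEmpty.{w + 1}, pfcStructure S⟩, (mem_pfcClass_iff hK).2
      ⟨_, _, S, inferInstance, inferInstance, fun b => b.elim, Equiv.refl _,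
        comapStructure_id _⟩, ?_⟩
    rintro ⟨X, T⟩ hX
    obtain ⟨A, B, S', -, -, -, i, hi⟩ := (mem_pfcClass_iff hK).1 hX
    have hi' : comapStructure i.symm T = pfcStructure S' := by
      rw [← hi, comapStructure_comp, Equiv.self_comp_symm, comapStructure_id]
    exact ⟨@embeddingOfComap (pfcLanguage L) _ _ _ (pfcStructure S) T
      (i.symm ∘ Sum.map PEmpty.elim PEmpty.elim) (by rintro (x | x) <;> exact x.elim)
      (comapStructure_trans (comapStructure_sumMap fun b => b.elim) hi')⟩
  refine ⟨⟨E, hE⟩, fun X hX => Structure.fg_iff_finite.2 (pfcClass_finite hX),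
    countable_quotient_of_finite fun X hX => pfcClass_finite hX, pfcClass_hereditary hK, ?_, ?_⟩
  · intro X hX Y hY
    obtain ⟨e⟩ := emb X hX
    obtain ⟨f⟩ := emb Y hY
    obtain ⟨D, hD, g, h, -⟩ := hSAP E X Y hE hX hY e f
    exact ⟨D, hD, ⟨g⟩, ⟨h⟩⟩
  · intro X Y Z e f hX hY hZ
    obtain ⟨D, hD, g, h, hgh, -⟩ := hSAP X Y Z hX hY hZ e f
    exact ⟨D, g, h, hD, hgh⟩

end Pfc

/-! ### The main theorem -/

theorem corollary4p7 {L : FirstOrder.Language.{u, v}} [L.IsRelational] [Finite (Σ n, L.Relations n)]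
    (K : Set (Bundled.{w} L.Structure)) (hK : IsFraisse K) (hSAP : StrongAmalgamation K)
    (M : Type w) [L.Structure M] [Countable M] [Nonempty M] (hM : IsFraisseLimit K M)
    (hgeom : IsGeometric.{u, v, w'} (L.completeTheory M))
    (hacl : HasTrivialAcl.{u, v, w'} (L.completeTheory M)) :
    (∃ (N : Type w) (_ : (pfcLanguage L).Structure N) (_ : Countable N),
      IsFraisseLimit (pfcClass K) N) ∧
    ∀ (N : Type w) [(pfcLanguage L).Structure N] [Countable N],
      IsFraisseLimit (pfcClass K) N →
        IsGeometric.{0, v, w'} ((pfcLanguage L).completeTheory N) ∧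
          HasTrivialAcl.{0, v, w'} ((pfcLanguage L).completeTheory N) := by
  have : Infinite M := infinite_of_strongAmalgamation hM hSAP
  have hSAP' : StrongAmalgamation (pfcClass K) := pfcClass_strongAmalgamation hK hSAP hM.age
  have : Finite (Σ n, (pfcLanguage L).Relations n) := finite_pfcRelations
  exact ⟨exists_isFraisseLimit (pfcClass_isFraisse hK hSAP'), fun N _ _ hN =>
    ⟨isGeometric_of_strongAmalgamation hN hSAP', hasTrivialAcl_of_strongAmalgamation hN hSAP'⟩⟩
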